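/- Let $(M,g)$ be a smooth $n$-dimensional Riemannian manifold with Levi-Civita connection $\nabla$, and let $\xi$ be a smooth unit vector field on $M$ ($g(\xi,\xi)=1$) that is parallel, $\nabla\xi=0$. Put $\pi(X)=g(X,\xi)$, $\phi=\tfrac12\pi$ and $\psi=\tfrac{n-1}{2(n+1)}\pi$, and let $\tilde\nabla$ be the projective semi-symmetric connection $$\tilde\nabla_XY=\nabla_XY+\psi(Y)X+\psi(X)Y+\phi(Y)X-\phi(X)Y .$$ For $D\in\{\nabla,\tilde\nabla\}$ let the curvature be $D_XD_YZ-D_YD_XZ-D_{[X,Y]}Z$, denoted $R(X,Y)Z$ for $\nabla$ and $\tilde R(X,Y)Z$ for $\tilde\nabla$; put $'\tilde R(X,Y,Z,U)=g(\tilde R(X,Y)Z,U)$ and $$(\tilde\nabla_X\tilde R)(Y,Z)U=\tilde\nabla_X(\tilde R(Y,Z)U)-\tilde R(\tilde\nabla_XY,Z)U-\tilde R(Y,\tilde\nabla_XZ)U-\tilde R(Y,Z)\tilde\nabla_XU .$$ Then: (i) $'\tilde R(X,Y,Z,U)=-\,'\tilde R(Y,X,Z,U)$ for all smooth vector fields $X,Y,Z,U$.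 (ii) If $n\ge 2$, then $\tilde R$ is not skew in its second pair of arguments: at every point $p\in M$ there are smooth vector fields $X,Y,Z,U$ with $'\tilde R(X,Y,Z,U)\neq-\,'\tilde R(X,Y,U,Z)$ at $p$. (iii) If $n\ge 2$, then $\tilde R$ lacks pair symmetry: at every point $p\in M$ there are smooth vector fields $X,Y,Z,U$ with $'\tilde R(X,Y,Z,U)\neq{}'\tilde R(Z,U,X,Y)$ at $p$. (iv) $\tilde R(X,Y)Z+\tilde R(Y,Z)X+\tilde R(Z,X)Y=0$ for all smooth vector fields $X,Y,Z$. (v) For all smooth vector fields $X,Y,Z,U$, $$(\tilde\nabla_X\tilde R)(Y,Z)U+(\tilde\nabla_Y\tilde R)(Z,X)U+(\tilde\nabla_Z\tilde R)(X,Y)U=2\,[\pi(X)R(Y,Z)U+\pi(Y)R(Z,X)U+\pi(Z)R(X,Y)U].$$ -/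

import Mathlib

open Bundle VectorField
open scoped Manifold ContDiff

namespace ProjSemiSymm

noncomputable section

variable {n : ℕ} {M : Type*} [TopologicalSpace M] [ChartedSpace (EuclideanSpace ℝ (Fin n)) M]

/-- A (possibly discontinuous) vector field on `M`. -/
abbrev VField (n : ℕ) (M : Type*) [TopologicalSpace M]
    [ChartedSpace (EuclideanSpace ℝ (Fin n)) M] : Type _ :=
  (p : M) → TangentSpace (𝓡 n) p

section Smooth

variable [IsManifold (𝓡 n) ∞ M]

/-- Smooth vector fields, i.e. `C^∞` sections of the tangent bundle. -/
def IsSmooth (X : VField n M) : Prop :=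
  ContMDiff (𝓡 n) (𝓡 n).tangent ∞ (fun p => (⟨p, X p⟩ : TangentBundle (𝓡 n) M))

/-- A linear (affine) connection on the tangent bundle of `M`; in Mathlib's argument order
`D Y p v` is the vector `D_v Y` at `p`. -/
abbrev Connection (n : ℕ) (M : Type*) [TopologicalSpace M]
    [ChartedSpace (EuclideanSpace ℝ (Fin n)) M] [IsManifold (𝓡 n) ∞ M] : Type _ :=
  CovariantDerivative (𝓡 n) (EuclideanSpace ℝ (Fin n)) (TangentSpace (𝓡 n) : M → Type _)

/-- The vector field `D_X Y`. -/
def along (D : Connection n M) (X Y : VField n M) : VField n M :=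
  fun p => D Y p (X p)

/-- The curvature `R(X, Y)Z = D_X D_Y Z - D_Y D_X Z - D_[X,Y] Z`. -/
def curvature (D : Connection n M) (X Y Z : VField n M) : VField n M :=
  fun p => along D X (along D Y Z) p - along D Y (along D X Z) p
    - along D (mlieBracket (𝓡 n) X Y) Z p

/-- The covariant derivative of the curvature tensor of `D` with respect to `D` itself:
`(D_X R)(Y, Z)U = D_X (R(Y, Z)U) - R(D_X Y, Z)U - R(Y, D_X Z)U - R(Y, Z)(D_X U)`. -/
def covDerivCurvature (D : Connection n M) (X Y Z U : VField n M) : VField n M :=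
  fun p => along D X (curvature D Y Z U) p - curvature D (along D X Y) Z U p
    - curvature D Y (along D X Z) U p - curvature D Y Z (along D X U) p

end Smooth

section Riemannian

variable [RiemannianBundle (fun p : M => TangentSpace (𝓡 n) p)]

/-- The 1-form `π(v) = g(v, ξ)`. -/
def piForm (ξ : VField n M) (p : M) (v : TangentSpace (𝓡 n) p) : ℝ := inner ℝ v (ξ p)

/-- The 1-form `φ = π / 2`. -/
def phiForm (ξ : VField n M) (p : M) (v : TangentSpace (𝓡 n) p) : ℝ :=
  (1 / 2 : ℝ) * piForm ξ p v

/-- The 1-form `ψ = (n - 1) / (2 (n + 1)) π`, where `n` is the dimension of `M`. -/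
def psiForm (ξ : VField n M) (p : M) (v : TangentSpace (𝓡 n) p) : ℝ :=
  (((n : ℝ) - 1) / (2 * ((n : ℝ) + 1))) * piForm ξ p v

variable [IsManifold (𝓡 n) ∞ M]

/-- The covariant curvature tensor `'R(X, Y, Z, U) = g(R(X, Y)Z, U)`, evaluated at `p`. -/
def curvature₄ (D : Connection n M) (X Y Z U : VField n M) (p : M) : ℝ :=
  inner ℝ (curvature D X Y Z p) (U p)

/-- `D'` is the projective semi-symmetric connection with characteristic vector field `ξ`
obtained from the Levi-Civita connection `D`:
`D'_v Y = D_v Y + ψ(Y) v + ψ(v) Y + φ(Y) v - φ(v) Y`. -/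
def IsProjectiveSemiSymmetric (D D' : Connection n M) (ξ : VField n M) : Prop :=
  ∀ (Y : VField n M) (p : M) (v : TangentSpace (𝓡 n) p),
    MDifferentiableAt (𝓡 n) (𝓡 n).tangent
      (fun q => (⟨q, Y q⟩ : TangentBundle (𝓡 n) M)) p →
    D' Y p v = D Y p v + psiForm ξ p (Y p) • v + psiForm ξ p v • Y p
      + phiForm ξ p (Y p) • v - phiForm ξ p v • Y p

/-- The connection just described is semi-symmetric: `T'(u, v) = π(v) u - π(u) v`. -/
theorem IsProjectiveSemiSymmetric.torsion_eq {D D' : Connection n M} {ξ : VField n M}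
    (hD : D.torsion = 0) (h : IsProjectiveSemiSymmetric D D' ξ) (p : M)
    (u v : TangentSpace (𝓡 n) p) :
    D'.torsion p u v = piForm ξ p v • u - piForm ξ p u • v := by
  have h0 : D.torsion p u v = 0 := by rw [hD]; rfl
  rw [CovariantDerivative.torsion_apply_eq_extend] at h0 ⊢
  rw [h _ _ _ (FiberBundle.mdifferentiableAt_extend ..),
    h _ _ _ (FiberBundle.mdifferentiableAt_extend ..)]
  simp only [FiberBundle.extend_apply_self] at h0 ⊢
  rw [← sub_eq_zero] at h0 ⊢
  rw [← h0]
  simp only [phiForm, psiForm]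
  module

/-- It has the same unparametrised geodesics as `D`: `D'_v Y - D_v Y` is a multiple of `v`
whenever `Y p = v`. -/
theorem IsProjectiveSemiSymmetric.projective {D D' : Connection n M} {ξ : VField n M}
    (h : IsProjectiveSemiSymmetric D D' ξ) (Y : VField n M) (p : M)
    (hY : MDifferentiableAt (𝓡 n) (𝓡 n).tangent
      (fun q => (⟨q, Y q⟩ : TangentBundle (𝓡 n) M)) p) :
    D' Y p (Y p) = D Y p (Y p) + (2 * psiForm ξ p (Y p)) • Y p := by
  rw [h _ _ _ hY]
  module

variable [IsContMDiffRiemannianBundle (𝓡 n) ∞ (EuclideanSpace ℝ (Fin n))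
  (fun p : M => TangentSpace (𝓡 n) p)]

set_option synthInstance.maxHeartbeats 400000 in
/-- `D` is the Levi-Civita connection of the metric: the smooth, torsion-free and metric
connection on the tangent bundle. -/
structure IsLeviCivita (D : Connection n M) : Prop where
  smooth : CovariantDerivative.ContMDiffCovariantDerivative D ∞
  torsion_free : D.torsion = 0
  metric : D.IsMetricCompatible

end Riemannian

end

end ProjSemiSymm

/-! Write the connection as `D'_v Y = D_v Y + a π(Y) v + b π(v) Y` with a = n/(n+1), b = -1/(n+1),
so a - b = 1. Since ξ is parallel, so is π. Antisymmetrizing second derivatives then cancels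
everything except one a² term (`IsPiDeformation.curvature_eq`): R'(X,Y)Z = R(X,Y)Z + a² π(Z)(π(Y)X -
π(X)Y). The correction has zero cyclic sum, so (iv) reduces to the first Bianchi identity for `D`.

Both R and R' take values in ker π, while R'(X,ξ)ξ = a² X for X orthogonal to ξ. Hence 'R'(X,ξ,ξ,X)
= a²|X|² is nonzero for X ≠ 0, but any component with ξ in the last slot vanishes; this gives (ii)
and (iii).

For (v), the correction to R is `D`-parallel, so D'R' differs from DR only through the action of `D'
- D` on R' (`IsPiDeformation.covDerivCurvature_eq`). In the cyclic sum DR drops out by the second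
Bianchi identity and the π(U) terms by (iv). What is left is 2(a - b) times the cyclic sum of
π(X)R'(Y,Z)U, where R' may be replaced by R. -/

namespace ProjSemiSymm

noncomputable section

/-! ### Derivatives along vector fields and Lie brackets. -/

section DirectionalDerivative

variable {n : ℕ} {M : Type*} [TopologicalSpace M] [ChartedSpace (EuclideanSpace ℝ (Fin n)) M]
  [IsManifold (𝓡 n) ∞ M]

/-- The derivative `X f` of a function along a vector field. -/
def dirDeriv (X : VField n M) (f : M → ℝ) : M → ℝ := fun p => mvfderiv (𝓡 n) f p (X p)

variable {X Y Z U : VField n M} {f g : M → ℝ} {D : Connection n M}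

theorem IsSmooth.mdifferentiableAt (hX : IsSmooth X) (p : M) :
    MDifferentiableAt (𝓡 n) (𝓡 n).tangent
      (fun q => (⟨q, X q⟩ : TangentBundle (𝓡 n) M)) p :=
  (ContMDiff.contMDiffAt hX).mdifferentiableAt (by simp)

theorem IsSmooth.add (hX : IsSmooth X) (hY : IsSmooth Y) : IsSmooth (X + Y) :=
  ContMDiff.add_section hX hY

theorem IsSmooth.sub (hX : IsSmooth X) (hY : IsSmooth Y) : IsSmooth (X - Y) :=
  ContMDiff.sub_section hX hY

theorem IsSmooth.smul (hf : ContMDiff (𝓡 n) 𝓘(ℝ) ∞ f) (hX : IsSmooth X) : IsSmooth (f • X) :=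
  ContMDiff.smul_section hf hX

theorem IsSmooth.mlieBracket (hX : IsSmooth X) (hY : IsSmooth Y) :
    IsSmooth (mlieBracket (𝓡 n) X Y) := by
  have : IsManifold (𝓡 n) (minSmoothness ℝ 2) M := by simp; infer_instance
  have : IsManifold (𝓡 n) (((⊤ : ℕ∞) : WithTop ℕ∞) + 1) M := by
    change IsManifold (𝓡 n) ∞ M; infer_instance
  exact ContDiff.mlieBracket_vectorField (m := ⊤) (n := ⊤) hX hY (by simp)

theorem IsSmooth.along (hD : CovariantDerivative.ContMDiffCovariantDerivative D ∞)
    (hX : IsSmooth X) (hY : IsSmooth Y) : IsSmooth (along D X Y) := by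
  have h := hD.contMDiff.contMDiff (σ := Y) (contMDiffOn_univ.2 hY)
  exact ContMDiff.clm_bundle_apply (contMDiffOn_univ.1 h) hX

theorem contMDiff_dirDeriv (hX : IsSmooth X) (hf : ContMDiff (𝓡 n) 𝓘(ℝ) ∞ f) :
    ContMDiff (𝓡 n) 𝓘(ℝ) ∞ (dirDeriv X f) := by
  have h := (hf.contMDiff_tangentMap (m := ∞) (by simp)).comp hX
  exact (contMDiff_snd_tangentBundle_modelSpace ℝ 𝓘(ℝ)).comp h

theorem along_add (hY : IsSmooth Y) (hZ : IsSmooth Z) (p : M) :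
    along D X (Y + Z) p = along D X Y p + along D X Z p := by
  simp [along, D.isCovariantDerivativeOnUniv.add (hY.mdifferentiableAt p) (hZ.mdifferentiableAt p)]

theorem along_smul (hf : ContMDiff (𝓡 n) 𝓘(ℝ) ∞ f) (hY : IsSmooth Y) (p : M) :
    along D X (f • Y) p = f p • along D X Y p + dirDeriv X f p • Y p := by
  simp [along, dirDeriv, D.isCovariantDerivativeOnUniv.leibniz (hY.mdifferentiableAt p)
    (hf.contMDiffAt.mdifferentiableAt (by simp))]

theorem along_sub (hY : IsSmooth Y) (hZ : IsSmooth Z) (p : M) :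
    along D X (Y - Z) p = along D X Y p - along D X Z p := by
  have h := along_add (D := D) (X := X) (hY.sub hZ) hZ p
  rw [sub_add_cancel] at h
  rw [h, add_sub_cancel_right]

theorem along_sub_along (hD : D.torsion = 0) (hX : IsSmooth X) (hY : IsSmooth Y) (p : M) :
    along D X Y p - along D Y X p = mlieBracket (𝓡 n) X Y p :=
  D.torsion_eq_zero_iff.1 hD (hX.mdifferentiableAt p) (hY.mdifferentiableAt p)

omit [IsManifold (𝓡 n) ∞ M] in
theorem dirDeriv_mul (hf : ContMDiff (𝓡 n) 𝓘(ℝ) ∞ f) (hg : ContMDiff (𝓡 n) 𝓘(ℝ) ∞ g) (p : M) :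
    dirDeriv X (f * g) p = f p * dirDeriv X g p + g p * dirDeriv X f p := by
  simp [dirDeriv, mvfderiv_mul (hf.contMDiffAt.mdifferentiableAt (by simp))
    (hg.contMDiffAt.mdifferentiableAt (by simp))]

theorem mlieBracket_smul_right_apply (hf : ContMDiff (𝓡 n) 𝓘(ℝ) ∞ f) (hY : IsSmooth Y) (p : M) :
    mlieBracket (𝓡 n) X (f • Y) p = dirDeriv X f p • Y p + f p • mlieBracket (𝓡 n) X Y p :=
  mlieBracket_smul_right (hf.contMDiffAt.mdifferentiableAt (by simp)) (hY.mdifferentiableAt p)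

theorem mlieBracket_smul_left_apply (hf : ContMDiff (𝓡 n) 𝓘(ℝ) ∞ f) (hX : IsSmooth X) (p : M) :
    mlieBracket (𝓡 n) (f • X) Y p = -dirDeriv Y f p • X p + f p • mlieBracket (𝓡 n) X Y p :=
  mlieBracket_smul_left (hf.contMDiffAt.mdifferentiableAt (by simp)) (hX.mdifferentiableAt p)

theorem mlieBracket_jacobi (hX : IsSmooth X) (hY : IsSmooth Y) (hZ : IsSmooth Z) (p : M) :
    mlieBracket (𝓡 n) X (mlieBracket (𝓡 n) Y Z) p =
      mlieBracket (𝓡 n) (mlieBracket (𝓡 n) X Y) Z p +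
        mlieBracket (𝓡 n) Y (mlieBracket (𝓡 n) X Z) p := by
  have h2 : minSmoothness ℝ 2 ≤ ∞ := by simp; exact WithTop.coe_le_coe.2 le_top
  have : IsManifold (𝓡 n) (minSmoothness ℝ 3) M := by simp; infer_instance
  exact leibniz_identity_mlieBracket_apply ((ContMDiff.contMDiffAt hX).of_le h2)
    ((ContMDiff.contMDiffAt hY).of_le h2) ((ContMDiff.contMDiffAt hZ).of_le h2)

/-- `[X, Y] f = X (Y f) - Y (X f)`, tested against a vector field. -/
theorem dirDeriv_mlieBracket_smul (hX : IsSmooth X) (hY : IsSmooth Y) (hZ : IsSmooth Z)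
    (hf : ContMDiff (𝓡 n) 𝓘(ℝ) ∞ f) (p : M) :
    dirDeriv (mlieBracket (𝓡 n) X Y) f p • Z p =
      (dirDeriv X (dirDeriv Y f) p - dirDeriv Y (dirDeriv X f) p) • Z p := by
  -- The mixed first-order terms are symmetric in A and B. They cancel in the Jacobi identity for X,
  -- Y, fZ, which therefore leaves only the second derivatives of f once f times the identity for X,
  -- Y, Z is removed.
  have key : ∀ {A B : VField n M}, IsSmooth A → IsSmooth B →
      mlieBracket (𝓡 n) A (mlieBracket (𝓡 n) B (f • Z)) p =
        dirDeriv A (dirDeriv B f) p • Z p + dirDeriv B f p • mlieBracket (𝓡 n) A Z p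
        + dirDeriv A f p • mlieBracket (𝓡 n) B Z p
        + f p • mlieBracket (𝓡 n) A (mlieBracket (𝓡 n) B Z) p := by
    intro A B hA hB
    have h1 : mlieBracket (𝓡 n) B (f • Z) = dirDeriv B f • Z + f • mlieBracket (𝓡 n) B Z :=
      funext fun q => mlieBracket_smul_right_apply hf hZ q
    have hB' := contMDiff_dirDeriv hB hf
    rw [h1, mlieBracket_add_right ((hZ.smul hB').mdifferentiableAt p)
      (((hB.mlieBracket hZ).smul hf).mdifferentiableAt p),
      mlieBracket_smul_right_apply hB' hZ, mlieBracket_smul_right_apply hf (hB.mlieBracket hZ)]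
    module
  have h := mlieBracket_jacobi hX hY (hZ.smul hf) p
  have h' := mlieBracket_jacobi hX hY hZ p
  rw [key hX hY, key hY hX, mlieBracket_smul_right_apply hf hZ, h'] at h
  linear_combination (norm := module) -h

end DirectionalDerivative

/-! ### Tensoriality of curvature and the Bianchi identities. -/

section CurvatureIdentities

variable {n : ℕ} {M : Type*} [TopologicalSpace M] [ChartedSpace (EuclideanSpace ℝ (Fin n)) M]
  [IsManifold (𝓡 n) ∞ M]

variable {W X Y Z U : VField n M} {f : M → ℝ} {D : Connection n M}

/-- A local smooth extension of v is cut off by a bump function supported where the extension is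
smooth. -/
theorem exists_isSmooth_eq [T2Space M] (p : M) (v : TangentSpace (𝓡 n) p) :
    ∃ X : VField n M, IsSmooth X ∧ X p = v := by
  obtain ⟨s, hs, hsv⟩ := FiberBundle.exists_contMDiffOn_extend (k := ∞) (𝓡 n)
    (EuclideanSpace ℝ (Fin n)) v
  obtain ⟨u, hus, hu, hpu⟩ := mem_nhds_iff.1 hs
  obtain ⟨f, hf, -⟩ := (SmoothBumpFunction.nhds_basis_support (I := 𝓡 n) (hu.mem_nhds hpu)).mem_iff.1
    (hu.mem_nhds hpu)
  refine ⟨(f : M → ℝ) • FiberBundle.extend (EuclideanSpace ℝ (Fin n)) v,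
    ContMDiffOn.smul_section_of_tsupport f.contMDiff.contMDiffOn hu hf (hsv.mono hus), ?_⟩
  simp

omit [IsManifold (𝓡 n) ∞ M] in
theorem dirDeriv_const_smul {c : ℝ} (hf : ContMDiff (𝓡 n) 𝓘(ℝ) ∞ f) (p : M) :
    dirDeriv X (c • f) p = c * dirDeriv X f p := by
  have h := dirDeriv_mul (X := X) (contMDiff_const (c := c)) hf p
  have h0 : dirDeriv X (fun _ => c) p = 0 := by
    simp only [dirDeriv, mvfderiv_const]
    rfl
  rw [h0, mul_zero, add_zero] at h
  exact h

theorem along_add_left (p : M) : along D (X + Y) Z p = along D X Z p + along D Y Z p :=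
  map_add _ _ _

theorem along_smul_left (p : M) : along D (f • X) Z p = f p • along D X Z p := by
  simp [along]

theorem IsSmooth.curvature (hD : CovariantDerivative.ContMDiffCovariantDerivative D ∞)
    (hX : IsSmooth X) (hY : IsSmooth Y) (hZ : IsSmooth Z) : IsSmooth (curvature D X Y Z) :=
  ((hX.along hD (hY.along hD hZ)).sub (hY.along hD (hX.along hD hZ))).sub
    ((hX.mlieBracket hY).along hD hZ)

theorem curvature_swap (D : Connection n M) (X Y Z : VField n M) (p : M) :
    curvature D X Y Z p = -curvature D Y X Z p := by
  have h : along D (mlieBracket (𝓡 n) X Y) Z p = -along D (mlieBracket (𝓡 n) Y X) Z p := by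
    simp only [along]
    rw [mlieBracket_swap_apply, map_neg]
  simp only [curvature, h]
  abel

theorem curvature_add_left (hD : CovariantDerivative.ContMDiffCovariantDerivative D ∞)
    (hW : IsSmooth W) (hX : IsSmooth X) (hZ : IsSmooth Z) (p : M) :
    curvature D (W + X) Y Z p = curvature D W Y Z p + curvature D X Y Z p := by
  have h1 : along D (W + X) Z = along D W Z + along D X Z := funext fun q => along_add_left q
  have h2 : along D (mlieBracket (𝓡 n) (W + X) Y) Z p =
      along D (mlieBracket (𝓡 n) W Y) Z p + along D (mlieBracket (𝓡 n) X Y) Z p := by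
    simp only [along]
    rw [mlieBracket_add_left (hW.mdifferentiableAt p) (hX.mdifferentiableAt p), map_add]
  simp only [curvature, h1, h2, along_add_left, along_add (hW.along hD hZ) (hX.along hD hZ)]
  abel

theorem curvature_smul_left (hD : CovariantDerivative.ContMDiffCovariantDerivative D ∞)
    (hf : ContMDiff (𝓡 n) 𝓘(ℝ) ∞ f) (hX : IsSmooth X) (hZ : IsSmooth Z) (p : M) :
    curvature D (f • X) Y Z p = f p • curvature D X Y Z p := by
  have h1 : along D (f • X) Z = f • along D X Z := funext fun q => along_smul_left q
  have h2 : along D (mlieBracket (𝓡 n) (f • X) Y) Z p =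
      -dirDeriv Y f p • along D X Z p + f p • along D (mlieBracket (𝓡 n) X Y) Z p := by
    simp only [along]
    rw [mlieBracket_smul_left_apply hf hX, map_add, map_smul, map_smul]
  simp only [curvature, h1, h2, along_smul_left, along_smul hf (hX.along hD hZ)]
  module

theorem curvature_add_middle (hD : CovariantDerivative.ContMDiffCovariantDerivative D ∞)
    (hW : IsSmooth W) (hY : IsSmooth Y) (hZ : IsSmooth Z) (p : M) :
    curvature D X (W + Y) Z p = curvature D X W Z p + curvature D X Y Z p := by
  rw [curvature_swap, curvature_add_left hD hW hY hZ, curvature_swap D W, curvature_swap D Y]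
  abel

theorem curvature_smul_middle (hD : CovariantDerivative.ContMDiffCovariantDerivative D ∞)
    (hf : ContMDiff (𝓡 n) 𝓘(ℝ) ∞ f) (hY : IsSmooth Y) (hZ : IsSmooth Z) (p : M) :
    curvature D X (f • Y) Z p = f p • curvature D X Y Z p := by
  rw [curvature_swap, curvature_smul_left hD hf hY hZ, curvature_swap D Y]
  module

theorem curvature_add_right (hD : CovariantDerivative.ContMDiffCovariantDerivative D ∞)
    (hX : IsSmooth X) (hY : IsSmooth Y) (hZ : IsSmooth Z) (hU : IsSmooth U) (p : M) :
    curvature D X Y (Z + U) p = curvature D X Y Z p + curvature D X Y U p := by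
  have h (V : VField n M) : along D V (Z + U) = along D V Z + along D V U :=
    funext fun q => along_add hZ hU q
  simp only [curvature, h, along_add (hY.along hD hZ) (hY.along hD hU),
    along_add (hX.along hD hZ) (hX.along hD hU), Pi.add_apply]
  abel

/-- The first-order terms in f are symmetric in X and Y, and the second-order ones cancel because
[X,Y]f = XYf - YXf. -/
theorem curvature_smul_right (hD : CovariantDerivative.ContMDiffCovariantDerivative D ∞)
    (hf : ContMDiff (𝓡 n) 𝓘(ℝ) ∞ f) (hX : IsSmooth X) (hY : IsSmooth Y) (hZ : IsSmooth Z)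
    (p : M) : curvature D X Y (f • Z) p = f p • curvature D X Y Z p := by
  have h (V : VField n M) : along D V (f • Z) = f • along D V Z + dirDeriv V f • Z :=
    funext fun q => along_smul hf hZ q
  have hXf := contMDiff_dirDeriv hX hf
  have hYf := contMDiff_dirDeriv hY hf
  have hXZ := hX.along hD hZ
  have hYZ := hY.along hD hZ
  simp only [curvature, h, along_add (hYZ.smul hf) (hZ.smul hYf),
    along_add (hXZ.smul hf) (hZ.smul hXf), along_smul hf hYZ, along_smul hf hXZ,
    along_smul hYf hZ, along_smul hXf hZ, Pi.add_apply, Pi.smul_apply',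
    dirDeriv_mlieBracket_smul hX hY hZ hf]
  module

theorem mlieBracket_jacobi_cyclic (hX : IsSmooth X) (hY : IsSmooth Y) (hZ : IsSmooth Z) (p : M) :
    mlieBracket (𝓡 n) (mlieBracket (𝓡 n) X Y) Z p
      + mlieBracket (𝓡 n) (mlieBracket (𝓡 n) Y Z) X p
      + mlieBracket (𝓡 n) (mlieBracket (𝓡 n) Z X) Y p = 0 := by
  have hJ := mlieBracket_jacobi hX hY hZ p
  have h : mlieBracket (𝓡 n) X Z = (-1 : ℝ) • mlieBracket (𝓡 n) Z X := by
    rw [mlieBracket_swap, neg_one_smul]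
  rw [mlieBracket_swap_apply (V := X), h,
    mlieBracket_const_smul_right ((hZ.mlieBracket hX).mdifferentiableAt p),
    mlieBracket_swap_apply (V := Y) (W := mlieBracket (𝓡 n) Z X)] at hJ
  linear_combination (norm := module) -hJ

/-- Zero torsion turns the regrouped cyclic sum into iterated brackets, and the Jacobi identity
finishes. -/
theorem first_bianchi (hD : CovariantDerivative.ContMDiffCovariantDerivative D ∞)
    (hT : D.torsion = 0) (hX : IsSmooth X) (hY : IsSmooth Y) (hZ : IsSmooth Z) (p : M) :
    curvature D X Y Z p + curvature D Y Z X p + curvature D Z X Y p = 0 := by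
  have key {A B C : VField n M} (hA : IsSmooth A) (hB : IsSmooth B) (hC : IsSmooth C) :
      along D A (along D B C) p - along D A (along D C B) p
        - along D (mlieBracket (𝓡 n) B C) A p
      = mlieBracket (𝓡 n) A (mlieBracket (𝓡 n) B C) p := by
    have h : along D B C - along D C B = mlieBracket (𝓡 n) B C :=
      funext fun q => along_sub_along hT hB hC q
    rw [← along_sub (hB.along hD hC) (hC.along hD hB), h,
      along_sub_along hT hA (hB.mlieBracket hC)]
  have hJ := mlieBracket_jacobi_cyclic hX hY hZ p
  rw [mlieBracket_swap_apply (V := mlieBracket (𝓡 n) X Y),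
    mlieBracket_swap_apply (V := mlieBracket (𝓡 n) Y Z),
    mlieBracket_swap_apply (V := mlieBracket (𝓡 n) Z X),
    ← key hX hY hZ, ← key hZ hX hY, ← key hY hZ hX] at hJ
  simp only [curvature]
  linear_combination (norm := module) -hJ

theorem second_bianchi (hD : CovariantDerivative.ContMDiffCovariantDerivative D ∞)
    (hT : D.torsion = 0) (hX : IsSmooth X) (hY : IsSmooth Y) (hZ : IsSmooth Z)
    (hU : IsSmooth U) (p : M) :
    covDerivCurvature D X Y Z U p + covDerivCurvature D Y Z X U p
      + covDerivCurvature D Z X Y U p = 0 := by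
  have hcurv {A B C : VField n M} (hB : IsSmooth B) (hC : IsSmooth C) :
      along D A (curvature D B C U) p = along D A (along D B (along D C U)) p
        - along D A (along D C (along D B U)) p
        - along D A (along D (mlieBracket (𝓡 n) B C) U) p := by
    have h : curvature D B C U = along D B (along D C U) - along D C (along D B U)
        - along D (mlieBracket (𝓡 n) B C) U := rfl
    have h1 := hB.along hD (hC.along hD hU)
    have h2 := hC.along hD (hB.along hD hU)
    rw [h, along_sub (h1.sub h2) ((hB.mlieBracket hC).along hD hU), along_sub h1 h2]
  -- After this exchange the R(D_B A, C) terms cancel cyclically by skewness. The rest is the Jacobi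
  -- identity for commutators of the operators D_A, together with that for brackets.
  have hadd {A B C : VField n M} (hA : IsSmooth A) (hB : IsSmooth B) :
      curvature D (along D A B) C U p =
        curvature D (along D B A) C U p + curvature D (mlieBracket (𝓡 n) A B) C U p := by
    have h : along D A B = along D B A + mlieBracket (𝓡 n) A B := funext fun q => by
      rw [Pi.add_apply, ← along_sub_along hT hA hB, add_sub_cancel]
    rw [h, curvature_add_left hD (hB.along hD hA) (hA.mlieBracket hB) hU]
  have hJ : along D (mlieBracket (𝓡 n) (mlieBracket (𝓡 n) X Y) Z) U p
      + along D (mlieBracket (𝓡 n) (mlieBracket (𝓡 n) Y Z) X) U p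
      + along D (mlieBracket (𝓡 n) (mlieBracket (𝓡 n) Z X) Y) U p = 0 := by
    simp only [along]
    rw [← map_add, ← map_add, mlieBracket_jacobi_cyclic hX hY hZ, map_zero]
  simp only [covDerivCurvature]
  rw [hcurv hY hZ, hcurv hZ hX, hcurv hX hY, hadd hX hY, hadd hY hZ, hadd hZ hX,
    curvature_swap D Y (along D X Z), curvature_swap D Z (along D Y X),
    curvature_swap D X (along D Z Y)]
  simp only [curvature]
  linear_combination (norm := module) hJ

end CurvatureIdentities

/-! ### Deforming the Levi-Civita connection by a parallel 1-form. -/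

section PiDeformation

variable {n : ℕ} {M : Type*} [TopologicalSpace M] [ChartedSpace (EuclideanSpace ℝ (Fin n)) M]
  [RiemannianBundle (fun p : M => TangentSpace (𝓡 n) p)]

/-- The function `π(Y)` for a vector field `Y`. -/
def piFun (ξ Y : VField n M) : M → ℝ := fun p => piForm ξ p (Y p)

theorem piForm_add (ξ : VField n M) (p : M) (v w : TangentSpace (𝓡 n) p) :
    piForm ξ p (v + w) = piForm ξ p v + piForm ξ p w :=
  inner_add_left _ _ _

theorem piForm_sub (ξ : VField n M) (p : M) (v w : TangentSpace (𝓡 n) p) :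
    piForm ξ p (v - w) = piForm ξ p v - piForm ξ p w :=
  inner_sub_left _ _ _

theorem piForm_smul (ξ : VField n M) (p : M) (c : ℝ) (v : TangentSpace (𝓡 n) p) :
    piForm ξ p (c • v) = c * piForm ξ p v :=
  real_inner_smul_left _ _ _

variable [IsManifold (𝓡 n) ∞ M]

/-- `D'_v Y = D_v Y + a π(Y) v + b π(v) Y`. -/
def IsPiDeformation (a b : ℝ) (D D' : Connection n M) (ξ : VField n M) : Prop :=
  ∀ (Y : VField n M) (p : M) (v : TangentSpace (𝓡 n) p),
    MDifferentiableAt (𝓡 n) (𝓡 n).tangent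
      (fun q => (⟨q, Y q⟩ : TangentBundle (𝓡 n) M)) p →
    D' Y p v = D Y p v + (a * piForm ξ p (Y p)) • v + (b * piForm ξ p v) • Y p

variable {D D' : Connection n M} {ξ X Y Z U : VField n M} {a b : ℝ}

/-- The two constants are the sum and the difference of the coefficients of ψ and φ. -/
theorem IsProjectiveSemiSymmetric.isPiDeformation (h : IsProjectiveSemiSymmetric D D' ξ) :
    IsPiDeformation ((n : ℝ) / (n + 1)) (-1 / (n + 1)) D D' ξ := by
  intro Y p v hY
  have hn : (n : ℝ) + 1 ≠ 0 := by positivity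
  have h1 : (n : ℝ) / (n + 1) = ((n : ℝ) - 1) / (2 * ((n : ℝ) + 1)) + 1 / 2 := by
    field_simp; ring
  have h2 : -1 / ((n : ℝ) + 1) = ((n : ℝ) - 1) / (2 * ((n : ℝ) + 1)) - 1 / 2 := by
    field_simp; ring
  rw [h Y p v hY, h1, h2]
  simp only [phiForm, psiForm]
  module

theorem IsPiDeformation.along_eq (h : IsPiDeformation a b D D' ξ) (hY : IsSmooth Y) (p : M) :
    along D' X Y p = along D X Y p + (a * piFun ξ Y p) • X p + (b * piFun ξ X p) • Y p :=
  h Y p (X p) (hY.mdifferentiableAt p)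

theorem IsPiDeformation.along_eq' (h : IsPiDeformation a b D D' ξ) (hY : IsSmooth Y) :
    along D' X Y = along D X Y + (a • piFun ξ Y) • X + (b • piFun ξ X) • Y :=
  funext fun p => h.along_eq hY p

variable [IsContMDiffRiemannianBundle (𝓡 n) ∞ (EuclideanSpace ℝ (Fin n))
  (fun p : M => TangentSpace (𝓡 n) p)]

theorem contMDiff_piFun (hξ : IsSmooth ξ) (hY : IsSmooth Y) :
    ContMDiff (𝓡 n) 𝓘(ℝ) ∞ (piFun ξ Y) :=
  ContMDiff.inner_bundle hY hξ

theorem contMDiff_smul_piFun (c : ℝ) (hξ : IsSmooth ξ) (hY : IsSmooth Y) :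
    ContMDiff (𝓡 n) 𝓘(ℝ) ∞ (c • piFun ξ Y) := by
  have h : ContMDiff (𝓡 n) 𝓘(ℝ) ∞ (fun _ : M => c) := contMDiff_const
  exact h.mul (contMDiff_piFun hξ hY)

-- This says that π is parallel: in the metric product rule the term containing Dξ vanishes.
set_option synthInstance.maxHeartbeats 400000 in
theorem dirDeriv_piFun (hD : IsLeviCivita D) (hξ : IsSmooth ξ)
    (hpar : ∀ (p : M) (v : TangentSpace (𝓡 n) p), D ξ p v = 0) (hY : IsSmooth Y) (p : M) :
    dirDeriv X (piFun ξ Y) p = piFun ξ (along D X Y) p := by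
  have h := hD.metric.mvfderiv_inner_eq X (hY.mdifferentiableAt p) (hξ.mdifferentiableAt p)
  simp only [hpar, inner_zero_right, add_zero] at h
  exact h

/-- As π commutes with D, the left side is (XY - YX - [X,Y]) applied to the function π(Z). -/
theorem piFun_curvature (hD : IsLeviCivita D) (hξ : IsSmooth ξ)
    (hunit : ∀ p : M, (inner ℝ (ξ p) (ξ p) : ℝ) = 1)
    (hpar : ∀ (p : M) (v : TangentSpace (𝓡 n) p), D ξ p v = 0)
    (hX : IsSmooth X) (hY : IsSmooth Y) (hZ : IsSmooth Z) (p : M) :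
    piForm ξ p (curvature D X Y Z p) = 0 := by
  have h (V W : VField n M) (hW : IsSmooth W) :
      dirDeriv V (piFun ξ W) = piFun ξ (along D V W) :=
    funext fun q => dirDeriv_piFun hD hξ hpar hW q
  -- Testing against ξ and applying π recovers the scalar identity, since π(ξ) = 1.
  have hc := congrArg (piForm ξ p)
    (dirDeriv_mlieBracket_smul hX hY hξ (contMDiff_piFun hξ hZ) p)
  have h1 : piForm ξ p (ξ p) = 1 := hunit p
  rw [piForm_smul, piForm_smul, h1, h _ _ hZ, h _ _ hZ, h _ _ hZ, h _ _ (hY.along hD.smooth hZ),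
    h _ _ (hX.along hD.smooth hZ)] at hc
  simp only [curvature, piForm_sub]
  simp only [piFun] at hc
  linarith

theorem IsPiDeformation.along_along_eq (h : IsPiDeformation a b D D' ξ) (hD : IsLeviCivita D)
    (hξ : IsSmooth ξ) (hpar : ∀ (p : M) (v : TangentSpace (𝓡 n) p), D ξ p v = 0)
    (hY : IsSmooth Y) (hZ : IsSmooth Z) (p : M) :
    along D' X (along D' Y Z) p = along D X (along D Y Z) p
      + (a * piFun ξ (along D X Z) p) • Y p + (a * piFun ξ Z p) • along D X Y p
      + (b * piFun ξ (along D X Y) p) • Z p + (b * piFun ξ Y p) • along D X Z p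
      + (a * (piFun ξ (along D Y Z) p + (a + b) * (piFun ξ Y p * piFun ξ Z p))) • X p
      + (b * piFun ξ X p) •
        (along D Y Z p + (a * piFun ξ Z p) • Y p + (b * piFun ξ Y p) • Z p) := by
  have hπY := contMDiff_piFun hξ hY
  have hπZ := contMDiff_piFun hξ hZ
  have hYZ := hY.along hD.smooth hZ
  have h1 := hY.smul (contMDiff_smul_piFun a hξ hZ)
  have h2 := hZ.smul (contMDiff_smul_piFun b hξ hY)
  have hπ : piFun ξ (along D Y Z + (a • piFun ξ Z) • Y + (b • piFun ξ Y) • Z) p =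
      piFun ξ (along D Y Z) p + (a + b) * (piFun ξ Y p * piFun ξ Z p) := by
    simp only [piFun, Pi.add_apply, Pi.smul_apply', Pi.smul_apply, smul_eq_mul, piForm_add,
      piForm_smul]
    ring
  rw [h.along_eq' hZ, h.along_eq ((hYZ.add h1).add h2), hπ, along_add (hYZ.add h1) h2,
    along_add hYZ h1, along_smul (contMDiff_smul_piFun a hξ hZ) hY,
    along_smul (contMDiff_smul_piFun b hξ hY) hZ, dirDeriv_const_smul hπZ, dirDeriv_const_smul hπY,
    dirDeriv_piFun hD hξ hpar hZ, dirDeriv_piFun hD hξ hpar hY]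
  simp only [Pi.add_apply, Pi.smul_apply', Pi.smul_apply, smul_eq_mul]
  module

/-- The curvature of the deformed connection: `R'(X, Y)Z = R(X, Y)Z + a² π(Z) (π(Y) X - π(X) Y)`. -/
theorem IsPiDeformation.curvature_eq (h : IsPiDeformation a b D D' ξ) (hD : IsLeviCivita D)
    (hξ : IsSmooth ξ) (hpar : ∀ (p : M) (v : TangentSpace (𝓡 n) p), D ξ p v = 0)
    (hX : IsSmooth X) (hY : IsSmooth Y) (hZ : IsSmooth Z) (p : M) :
    curvature D' X Y Z p = curvature D X Y Z p
      + (a ^ 2 * piFun ξ Z p) • (piFun ξ Y p • X p - piFun ξ X p • Y p) := by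
  have key {A B : VField n M} (hB : IsSmooth B) :=
    h.along_along_eq (X := A) hD hξ hpar hB hZ p
  have hT : piFun ξ (mlieBracket (𝓡 n) X Y) p =
      piFun ξ (along D X Y) p - piFun ξ (along D Y X) p := by
    simp only [piFun]
    rw [← along_sub_along hD.torsion_free hX hY, piForm_sub]
  simp only [curvature]
  -- The terms linear in π cancel by symmetry or against the bracket term; the quadratic ones leave
  -- a(a + b) - ab = a².
  rw [key hY, key hX, h.along_eq hZ, hT, ← along_sub_along hD.torsion_free hX hY]
  module

theorem IsPiDeformation.isSmooth_along (h : IsPiDeformation a b D D' ξ) (hD : IsLeviCivita D)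
    (hξ : IsSmooth ξ) (hX : IsSmooth X) (hY : IsSmooth Y) : IsSmooth (along D' X Y) := by
  rw [h.along_eq' hY]
  exact ((hX.along hD.smooth hY).add (hX.smul (contMDiff_smul_piFun a hξ hY))).add
    (hY.smul (contMDiff_smul_piFun b hξ hX))

/-- `D'_X - D_X` acts on R' as a derivation. Its b part scales by bπ(X), once on the value and minus
once per slot: b - 3b = -2b. Its a part puts X in each slot in turn and does nothing to the value,
because π(R') = 0. -/
theorem IsPiDeformation.covDerivCurvature_eq (h : IsPiDeformation a b D D' ξ)
    (hD : IsLeviCivita D) (hξ : IsSmooth ξ)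
    (hunit : ∀ p : M, (inner ℝ (ξ p) (ξ p) : ℝ) = 1)
    (hpar : ∀ (p : M) (v : TangentSpace (𝓡 n) p), D ξ p v = 0)
    (hX : IsSmooth X) (hY : IsSmooth Y) (hZ : IsSmooth Z) (hU : IsSmooth U) (p : M) :
    covDerivCurvature D' X Y Z U p = covDerivCurvature D X Y Z U p
      - (2 * b * piFun ξ X p) • curvature D' Y Z U p
      + (a * piFun ξ Y p) • curvature D' Z X U p
      + (a * piFun ξ Z p) • curvature D' X Y U p
      - (a * piFun ξ U p) • curvature D' Y Z X p := by
  have hπ {A : VField n M} (hA : IsSmooth A) := contMDiff_piFun hξ hA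
  have hc {A : VField n M} (c : ℝ) (hA : IsSmooth A) : ContMDiff (𝓡 n) 𝓘(ℝ) ∞ (c • piFun ξ A) :=
    contMDiff_smul_piFun c hξ hA
  have hs := hD.smooth
  have hd {A : VField n M} (hA : IsSmooth A) := dirDeriv_piFun (X := X) hD hξ hpar hA p
  have hS {A B C : VField n M} (hA : IsSmooth A) (hB : IsSmooth B) (hC : IsSmooth C) :=
    h.curvature_eq hD hξ hpar hA hB hC p
  have hR : curvature D' Y Z U = curvature D Y Z U
      + ((((a ^ 2) • piFun ξ U) * piFun ξ Z) • Y - (((a ^ 2) • piFun ξ U) * piFun ξ Y) • Z) :=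
    funext fun q => by
      rw [h.curvature_eq hD hξ hpar hY hZ hU]
      simp only [Pi.add_apply, Pi.sub_apply, Pi.smul_apply', Pi.mul_apply, Pi.smul_apply,
        smul_eq_mul]
      module
  have hg {A B : VField n M} (hA : IsSmooth A) (hB : IsSmooth B) :
      ContMDiff (𝓡 n) 𝓘(ℝ) ∞ (((a ^ 2) • piFun ξ A) * piFun ξ B) := (hc _ hA).mul (hπ hB)
  have hdg {A B : VField n M} (hA : IsSmooth A) (hB : IsSmooth B) :
      dirDeriv X (((a ^ 2) • piFun ξ A) * piFun ξ B) p =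
        a ^ 2 * (piFun ξ A p * piFun ξ (along D X B) p
          + piFun ξ B p * piFun ξ (along D X A) p) := by
    rw [dirDeriv_mul (hc _ hA) (hπ hB), dirDeriv_const_smul (hπ hA), hd hA, hd hB]
    simp only [Pi.smul_apply, smul_eq_mul]
    ring
  have hπR : piFun ξ (curvature D Y Z U) p = 0 := piFun_curvature hD hξ hunit hpar hY hZ hU p
  have hRs := hY.curvature hs hZ hU
  have hfst : along D' X (curvature D' Y Z U) p = along D X (curvature D Y Z U) p
      + (a ^ 2 * (piFun ξ U p * piFun ξ (along D X Z) p
          + piFun ξ Z p * piFun ξ (along D X U) p)) • Y p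
      + (a ^ 2 * piFun ξ U p * piFun ξ Z p) • along D X Y p
      - (a ^ 2 * (piFun ξ U p * piFun ξ (along D X Y) p
          + piFun ξ Y p * piFun ξ (along D X U) p)) • Z p
      - (a ^ 2 * piFun ξ U p * piFun ξ Y p) • along D X Z p
      + (b * piFun ξ X p) • curvature D' Y Z U p := by
    have h1 := hY.smul (hg hU hZ)
    have h2 := hZ.smul (hg hU hY)
    have hπR' : piFun ξ (curvature D' Y Z U) p = 0 := by
      simp only [piFun] at hπR ⊢
      rw [hS hY hZ hU]
      simp only [piForm_add, piForm_sub, piForm_smul, hπR, piFun]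
      ring
    rw [h.along_eq (hR ▸ hRs.add (h1.sub h2)), hπR', hR, along_add hRs (h1.sub h2),
      along_sub h1 h2, along_smul (hg hU hZ) hY, along_smul (hg hU hY) hZ, hdg hU hZ, hdg hU hY]
    simp only [Pi.mul_apply, Pi.smul_apply, smul_eq_mul]
    module
  have hXY := hX.along hs hY
  have hXZ := hX.along hs hZ
  have hXU := hX.along hs hU
  have h1 : curvature D (along D' X Y) Z U p = curvature D (along D X Y) Z U p
      + (a * piFun ξ Y p) • curvature D X Z U p + (b * piFun ξ X p) • curvature D Y Z U p := by
    rw [h.along_eq' hY, curvature_add_left hs (hXY.add (hX.smul (hc a hY))) (hY.smul (hc b hX)) hU,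
      curvature_add_left hs hXY (hX.smul (hc a hY)) hU, curvature_smul_left hs (hc a hY) hX hU,
      curvature_smul_left hs (hc b hX) hY hU]
    rfl
  have h2 : curvature D Y (along D' X Z) U p = curvature D Y (along D X Z) U p
      + (a * piFun ξ Z p) • curvature D Y X U p + (b * piFun ξ X p) • curvature D Y Z U p := by
    rw [h.along_eq' hZ, curvature_add_middle hs (hXZ.add (hX.smul (hc a hZ))) (hZ.smul (hc b hX))
      hU, curvature_add_middle hs hXZ (hX.smul (hc a hZ)) hU,
      curvature_smul_middle hs (hc a hZ) hX hU, curvature_smul_middle hs (hc b hX) hZ hU]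
    rfl
  have h3 : curvature D Y Z (along D' X U) p = curvature D Y Z (along D X U) p
      + (a * piFun ξ U p) • curvature D Y Z X p + (b * piFun ξ X p) • curvature D Y Z U p := by
    rw [h.along_eq' hU, curvature_add_right hs hY hZ (hXU.add (hX.smul (hc a hU)))
      (hU.smul (hc b hX)), curvature_add_right hs hY hZ hXU (hX.smul (hc a hU)),
      curvature_smul_right hs (hc a hU) hY hZ hX, curvature_smul_right hs (hc b hX) hY hZ hU]
    rfl
  have hπA {A : VField n M} (hA : IsSmooth A) : piFun ξ (along D' X A) p =
      piFun ξ (along D X A) p + (a * piFun ξ A p) * piFun ξ X p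
        + (b * piFun ξ X p) * piFun ξ A p := by
    simp only [piFun]
    rw [h.along_eq hA, piForm_add, piForm_add, piForm_smul, piForm_smul]
    rfl
  simp only [covDerivCurvature]
  rw [hfst, hS (h.isSmooth_along hD hξ hX hY) hZ hU, hS hY (h.isSmooth_along hD hξ hX hZ) hU,
    hS hY hZ (h.isSmooth_along hD hξ hX hU), h1, h2, h3, hπA hY, hπA hZ, hπA hU,
    h.along_eq hY, h.along_eq hZ, hS hY hZ hU, hS hZ hX hU, hS hX hY hU, hS hY hZ hX,
    curvature_swap D X Z, curvature_swap D Y X]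
  module

end PiDeformation

/-! ### Failure of the symmetries involving the last argument. -/

section Asymmetry

variable {n : ℕ} {M : Type*} [TopologicalSpace M] [ChartedSpace (EuclideanSpace ℝ (Fin n)) M]
  [RiemannianBundle (fun p : M => TangentSpace (𝓡 n) p)]

theorem exists_ne_zero_piForm_eq_zero (hn : 2 ≤ n) (ξ : VField n M) (p : M) :
    ∃ v : TangentSpace (𝓡 n) p, v ≠ 0 ∧ piForm ξ p v = 0 := by
  have hdim : Module.finrank ℝ (TangentSpace (𝓡 n) p) = n :=
    finrank_euclideanSpace_fin (𝕜 := ℝ) (n := n)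
  have : FiniteDimensional ℝ (TangentSpace (𝓡 n) p) :=
    inferInstanceAs (FiniteDimensional ℝ (EuclideanSpace ℝ (Fin n)))
  have h := LinearMap.ker_ne_bot_of_finrank_lt (f := (innerₗ (TangentSpace (𝓡 n) p)) (ξ p))
    (by rw [hdim, Module.finrank_self]; omega)
  obtain ⟨v, hv, hv0⟩ := Submodule.exists_mem_ne_zero_of_ne_bot h
  exact ⟨v, hv0, (real_inner_comm _ _).trans hv⟩

variable [IsManifold (𝓡 n) ∞ M] {D D' : Connection n M} {ξ X Y Z U : VField n M} {a b : ℝ}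

omit [RiemannianBundle (fun p : M => TangentSpace (𝓡 n) p)] in
theorem curvature_eq_zero_of_parallel (hpar : ∀ (p : M) (v : TangentSpace (𝓡 n) p), D ξ p v = 0)
    (p : M) : curvature D X Y ξ p = 0 := by
  have h (V : VField n M) : along D V ξ = 0 := funext fun q => hpar q (V q)
  have h0 (V : VField n M) : along D V (0 : VField n M) p = 0 := by simp [along]
  simp [curvature, h, h0]

variable [IsContMDiffRiemannianBundle (𝓡 n) ∞ (EuclideanSpace ℝ (Fin n))
  (fun p : M => TangentSpace (𝓡 n) p)]

theorem IsPiDeformation.curvature₄_eq_zero (h : IsPiDeformation a b D D' ξ) (hD : IsLeviCivita D)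
    (hξ : IsSmooth ξ) (hunit : ∀ p : M, (inner ℝ (ξ p) (ξ p) : ℝ) = 1)
    (hpar : ∀ (p : M) (v : TangentSpace (𝓡 n) p), D ξ p v = 0)
    (hX : IsSmooth X) (hY : IsSmooth Y) (hZ : IsSmooth Z) (p : M) :
    curvature₄ D' X Y Z ξ p = 0 := by
  change piForm ξ p _ = 0
  rw [h.curvature_eq hD hξ hpar hX hY hZ, piForm_add, piForm_smul, piForm_sub, piForm_smul,
    piForm_smul, piFun_curvature hD hξ hunit hpar hX hY hZ]
  simp only [piFun]
  ring

/-- For X orthogonal to ξ at p, R(X,ξ)ξ = 0 and the correction is a² X. -/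
theorem IsPiDeformation.exists_curvature₄_ne_zero [T2Space M] (hn : 2 ≤ n) (ha : a ≠ 0)
    (h : IsPiDeformation a b D D' ξ) (hD : IsLeviCivita D)
    (hξ : IsSmooth ξ) (hunit : ∀ p : M, (inner ℝ (ξ p) (ξ p) : ℝ) = 1)
    (hpar : ∀ (p : M) (v : TangentSpace (𝓡 n) p), D ξ p v = 0) (p : M) :
    ∃ X : VField n M, IsSmooth X ∧ curvature₄ D' X ξ ξ X p ≠ 0 := by
  obtain ⟨v, hv0, hv⟩ := exists_ne_zero_piForm_eq_zero hn ξ p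
  obtain ⟨X, hX, rfl⟩ := exists_isSmooth_eq p v
  have h1 : piForm ξ p (ξ p) = 1 := hunit p
  refine ⟨X, hX, ?_⟩
  simp only [curvature₄]
  rw [h.curvature_eq hD hξ hpar hX hξ hξ, curvature_eq_zero_of_parallel hpar]
  simp only [piFun, hv, h1, zero_smul, sub_zero, one_smul, zero_add, mul_one]
  rw [real_inner_smul_left]
  exact mul_ne_zero (pow_ne_zero 2 ha) (inner_self_ne_zero.2 hv0)

end Asymmetry

end

end ProjSemiSymm

/-! ### The five curvature properties. -/

open ProjSemiSymm in
theorem theorem2p1 {n : ℕ} {M : Type*} [TopologicalSpace M] [T2Space M]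
    [ChartedSpace (EuclideanSpace ℝ (Fin n)) M] [IsManifold (𝓡 n) ∞ M]
    [RiemannianBundle (fun p : M => TangentSpace (𝓡 n) p)]
    [IsContMDiffRiemannianBundle (𝓡 n) ∞ (EuclideanSpace ℝ (Fin n))
      (fun p : M => TangentSpace (𝓡 n) p)]
    (D D' : ProjSemiSymm.Connection n M) (ξ : ProjSemiSymm.VField n M)
    (hD : ProjSemiSymm.IsLeviCivita D)
    (hξ : ProjSemiSymm.IsSmooth ξ)
    (hunit : ∀ p : M, (inner ℝ (ξ p) (ξ p) : ℝ) = 1)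
    (hparallel : ∀ (p : M) (v : TangentSpace (𝓡 n) p), D ξ p v = 0)
    (hD' : ProjSemiSymm.IsProjectiveSemiSymmetric D D' ξ) :
    (∀ X Y Z U : ProjSemiSymm.VField n M,
      ProjSemiSymm.IsSmooth X → ProjSemiSymm.IsSmooth Y →
      ProjSemiSymm.IsSmooth Z → ProjSemiSymm.IsSmooth U → ∀ p : M,
        ProjSemiSymm.curvature₄ D' X Y Z U p = - ProjSemiSymm.curvature₄ D' Y X Z U p) ∧
    (2 ≤ n → ∀ p : M, ∃ X Y Z U : ProjSemiSymm.VField n M,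
      ProjSemiSymm.IsSmooth X ∧ ProjSemiSymm.IsSmooth Y ∧
      ProjSemiSymm.IsSmooth Z ∧ ProjSemiSymm.IsSmooth U ∧
        ProjSemiSymm.curvature₄ D' X Y Z U p ≠ - ProjSemiSymm.curvature₄ D' X Y U Z p) ∧
    (2 ≤ n → ∀ p : M, ∃ X Y Z U : ProjSemiSymm.VField n M,
      ProjSemiSymm.IsSmooth X ∧ ProjSemiSymm.IsSmooth Y ∧
      ProjSemiSymm.IsSmooth Z ∧ ProjSemiSymm.IsSmooth U ∧
        ProjSemiSymm.curvature₄ D' X Y Z U p ≠ ProjSemiSymm.curvature₄ D' Z U X Y p) ∧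
    (∀ X Y Z : ProjSemiSymm.VField n M,
      ProjSemiSymm.IsSmooth X → ProjSemiSymm.IsSmooth Y → ProjSemiSymm.IsSmooth Z →
      ∀ p : M,
        ProjSemiSymm.curvature D' X Y Z p + ProjSemiSymm.curvature D' Y Z X p
          + ProjSemiSymm.curvature D' Z X Y p = 0) ∧
    (∀ X Y Z U : ProjSemiSymm.VField n M,
      ProjSemiSymm.IsSmooth X → ProjSemiSymm.IsSmooth Y →
      ProjSemiSymm.IsSmooth Z → ProjSemiSymm.IsSmooth U → ∀ p : M,
        ProjSemiSymm.covDerivCurvature D' X Y Z U p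
          + ProjSemiSymm.covDerivCurvature D' Y Z X U p
          + ProjSemiSymm.covDerivCurvature D' Z X Y U p
        = (2 : ℝ) • (ProjSemiSymm.piForm ξ p (X p) • ProjSemiSymm.curvature D Y Z U p
          + ProjSemiSymm.piForm ξ p (Y p) • ProjSemiSymm.curvature D Z X U p
          + ProjSemiSymm.piForm ξ p (Z p) • ProjSemiSymm.curvature D X Y U p)) := by
  have h := hD'.isPiDeformation
  have hs := hD.smooth
  have hT := hD.torsion_free
  have hn1 : (n : ℝ) + 1 ≠ 0 := by positivity
  refine ⟨fun X Y Z U _ _ _ _ p => ?_, fun hn p => ?_, fun hn p => ?_,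
    fun X Y Z hX hY hZ p => ?_, fun X Y Z U hX hY hZ hU p => ?_⟩
  · simp only [curvature₄]
    rw [curvature_swap, inner_neg_left]
  · have hn0 : (n : ℝ) ≠ 0 := by positivity
    obtain ⟨X, hX, hne⟩ := h.exists_curvature₄_ne_zero hn (div_ne_zero hn0 hn1) hD hξ hunit
      hparallel p
    refine ⟨X, ξ, ξ, X, hX, hξ, hξ, hX, ?_⟩
    rwa [h.curvature₄_eq_zero hD hξ hunit hparallel hX hξ hX, neg_zero]
  · have hn0 : (n : ℝ) ≠ 0 := by positivity
    obtain ⟨X, hX, hne⟩ := h.exists_curvature₄_ne_zero hn (div_ne_zero hn0 hn1) hD hξ hunit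
      hparallel p
    refine ⟨X, ξ, ξ, X, hX, hξ, hξ, hX, ?_⟩
    rwa [h.curvature₄_eq_zero hD hξ hunit hparallel hξ hX hX]
  · rw [h.curvature_eq hD hξ hparallel hX hY hZ, h.curvature_eq hD hξ hparallel hY hZ hX,
      h.curvature_eq hD hξ hparallel hZ hX hY]
    linear_combination (norm := module) first_bianchi hs hT hX hY hZ p
  · have e {A B C : VField n M} (hA : IsSmooth A) (hB : IsSmooth B) (hC : IsSmooth C) :=
      h.covDerivCurvature_eq hD hξ hunit hparallel hA hB hC hU p
    have c {A B C : VField n M} (hA : IsSmooth A) (hB : IsSmooth B) (hC : IsSmooth C) :=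
      h.curvature_eq hD hξ hparallel hA hB hC p
    -- The relation b = a - 1 is what makes the factor 2(a - b) equal to 2.
    have hab : -1 / ((n : ℝ) + 1) = n / (n + 1) - 1 := by field_simp; ring
    rw [e hX hY hZ, e hY hZ hX, e hZ hX hY, c hX hY hU, c hY hZ hU, c hZ hX hU,
      c hX hY hZ, c hY hZ hX, c hZ hX hY, hab]
    simp only [piFun]
    linear_combination (norm := module) second_bianchi hs hT hX hY hZ hU p
      - ((n : ℝ) / (n + 1) * piForm ξ p (U p)) • first_bianchi hs hT hX hY hZ p
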